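/- An ordered tree is a rooted tree in which the children of every node are linearly ordered (from left to right). Let $\mathcal T_n$ be the set of ordered trees with $n$ edges; the level of a node is its distance from the root, and $\mathrm{lev}(T,\ell)$ is the set of nodes of $T$ at level $\ell$. Depth-first search (DFS) visits the nodes of $T$ in pre-order (the root first, then recursively the subtrees of its children from left to right); truncated DFS with target level $\ell$ does the same but ignores all nodes at levels greater than $\ell$. For a node $v$, let $\mathrm{dfsScore}(v)$ be the number of nodes visited before $v$ by DFS and, if $v$ is at level $\ell$, let $\mathrm{dfsTruncScore}(v)$ be the number of nodes visited before $v$ by truncated DFS with target level $\ell$. Put $$\mathrm{totalD}(n,\ell)=\sum_{T\in\mathcal T_n}\ \sum_{v\in\mathrm{lev}(T,\ell)}\mathrm{dfsScore}(v),\qquad \mathrm{totalDTrunc}(n,\ell)=\sum_{T\in\mathcal T_n}\ \sum_{v\in\mathrm{lev}(T,\ell)}\mathrm{dfsTruncScore}(v).$$ **Theorem.** For all integers $n\ge 1$ and $0\le \ell\le n$, \begin{align*} &\mathrm{totalD}(n,\ell)-\mathrm{totalDTrunc}(n,\ell)=\\ &\quad\frac12\sum_{k=0}^{\lfloor(\ell-1)/2\rfloor}(-1)^k\binom{\ell-1-k}{k}\left(\frac{\ell}{n-k+\ell}\binom{2(n-k)+\ell-1}{n-k}-\frac{6\ell+4}{n-k+2\ell+1}\binom{2(n-k)+\ell-1}{n-k-\ell-1}\right)\\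 &\quad+\frac12\sum_{k=0}^{\lfloor\ell/2\rfloor}(-1)^k\binom{\ell-k}{k}\left(\frac{(3\ell+1)(2k-\ell+1)}{n-k+2\ell+1}\binom{2(n-k)+\ell}{n-k-\ell}-\frac{(3\ell+2)k}{n-k+2\ell+2}\binom{2(n-k)+\ell+1}{n-k-\ell}\right)\\ &\quad+\frac12\sum_{k=0}^{n-\ell}\left(\frac{\ell}{n-k+\ell}\left(4^{k+1}(\ell+1)-2\binom{2k}{k}\right)\binom{2n-2k-1}{n-k-\ell}-\frac{4^k(2\ell+1)(\ell+1)}{n-k+\ell+1}\binom{2n-2k}{n-k-\ell}\right)-\frac12\binom{2n}{n}. \end{align*} Here $\binom ab=\frac{a(a-1)\cdots(a-b+1)}{b!}$ for integers $a$ and $b\ge0$ (so $\binom a0=1$ for every $a$), $\binom ab=0$ for $b<0$, and a sum whose upper limit is negative is empty. In the case $\ell=0$, $k=n$ of the last sum, the undefined quotient $\frac{\ell}{n-k+\ell}=\frac00$ is read as $\frac12$. -/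

import Mathlib

/-- Ordered (plane, rooted) trees: a root together with the list, from left to right, of the
subtrees hanging from it. -/
inductive OrderedTree : Type where
  | node (children : List OrderedTree) : OrderedTree

namespace OrderedTree

/-- The number of edges of an ordered tree. -/
def edges : OrderedTree → ℕ
  | node cs => (cs.map fun c => edges c + 1).sum

/-- Nodes are addressed by words: the root is `[]`, and `i :: v` is the node `v` of the subtree
hanging from the `i`-th child of the root (children are numbered `0, 1, …` from left to right).
`IsNode T v` says that `T` has a node with the address `v`. The level (distance from the root)
of a node is the length of its address. -/
def IsNode : OrderedTree → List ℕ → Prop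
  | _, [] => True
  | node cs, i :: v => ∃ c, cs[i]? = some c ∧ IsNode c v

/-- The nodes in the order in which depth-first search visits them: first the root, and then,
for each child of the root from left to right, all the nodes of the subtree of that child, in
depth-first order. -/
def dfsOrder : OrderedTree → List (List ℕ)
  | node cs => [] :: (cs.attach.mapIdx fun i c => (dfsOrder c.1).map (i :: ·)).flatten
decreasing_by
  have := List.sizeOf_lt_of_mem c.2
  simp
  omega

/-- The nodes visited by truncated depth-first search with target level `ℓ`, in the order in
which they are visited: depth-first search that does not go below level `ℓ`. -/
def dfsTruncOrder : ℕ → OrderedTree → List (List ℕ)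
  | 0, _ => [[]]
  | ℓ + 1, node cs => [] :: (cs.mapIdx fun i c => (dfsTruncOrder ℓ c).map (i :: ·)).flatten

theorem dfsOrder_node (cs : List OrderedTree) :
    dfsOrder (node cs) = [] :: (cs.mapIdx fun i c => (dfsOrder c).map (i :: ·)).flatten := by
  rw [dfsOrder]
  congr 2
  exact List.ext_getElem (by simp) fun i _ _ => by simp

/-- Depth-first search visits exactly the nodes of the tree. -/
theorem mem_dfsOrder : ∀ (T : OrderedTree) (v : List ℕ), v ∈ dfsOrder T ↔ IsNode T v
  | node cs, [] => by simp [dfsOrder_node, IsNode]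
  | node cs, i :: v => by
    have ih := fun c => mem_dfsOrder c v
    simp only [dfsOrder_node, IsNode, List.mem_cons, reduceCtorEq, false_or, List.mem_flatten,
      List.mem_mapIdx]
    constructor
    · rintro ⟨l, ⟨j, hj, rfl⟩, hv⟩
      simp only [List.mem_map, List.cons.injEq] at hv
      obtain ⟨w, hw, rfl, rfl⟩ := hv
      exact ⟨cs[j], by simp [hj], (ih _).1 hw⟩
    · rintro ⟨c, hc, hv⟩
      obtain ⟨hi, rfl⟩ := List.getElem?_eq_some_iff.1 hc
      exact ⟨_, ⟨i, hi, rfl⟩, List.mem_map.2 ⟨v, (ih _).2 hv, rfl⟩⟩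

/-- Truncated depth-first search visits exactly the nodes at levels `0, …, ℓ`. -/
theorem mem_dfsTruncOrder : ∀ (ℓ : ℕ) (T : OrderedTree) (v : List ℕ),
    v ∈ dfsTruncOrder ℓ T ↔ IsNode T v ∧ v.length ≤ ℓ
  | 0, T, [] => by simp [dfsTruncOrder, IsNode]
  | 0, T, i :: v => by simp [dfsTruncOrder]
  | ℓ + 1, node cs, [] => by simp [dfsTruncOrder, IsNode]
  | ℓ + 1, node cs, i :: v => by
    have ih := fun c => mem_dfsTruncOrder ℓ c v
    simp only [dfsTruncOrder, IsNode, List.mem_cons, reduceCtorEq, false_or, List.mem_flatten,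
      List.mem_mapIdx, List.length_cons, Nat.add_le_add_iff_right]
    constructor
    · rintro ⟨l, ⟨j, hj, rfl⟩, hv⟩
      simp only [List.mem_map, List.cons.injEq] at hv
      obtain ⟨w, hw, rfl, rfl⟩ := hv
      exact ⟨⟨cs[j], by simp [hj], ((ih _).1 hw).1⟩, ((ih _).1 hw).2⟩
    · rintro ⟨⟨c, hc, hv⟩, hl⟩
      obtain ⟨hi, rfl⟩ := List.getElem?_eq_some_iff.1 hc
      exact ⟨_, ⟨i, hi, rfl⟩, List.mem_map.2 ⟨v, (ih _).2 ⟨hv, hl⟩, rfl⟩⟩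

theorem finite_level (T : OrderedTree) (ℓ : ℕ) : {v | IsNode T v ∧ v.length = ℓ}.Finite :=
  (dfsOrder T).toFinset.finite_toSet.subset fun v hv => by
    simpa using (mem_dfsOrder T v).2 hv.1

/-- The set of nodes of `T` at level `ℓ`. -/
noncomputable def lev (T : OrderedTree) (ℓ : ℕ) : Finset (List ℕ) :=
  (finite_level T ℓ).toFinset

/-- The number of nodes of `T` visited before `v` by depth-first search. -/
def dfsScore (T : OrderedTree) (v : List ℕ) : ℕ :=
  (dfsOrder T).idxOf v

/-- The number of nodes of `T` visited before `v` by truncated depth-first search with target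
level `ℓ`. -/
def dfsTruncScore (ℓ : ℕ) (T : OrderedTree) (v : List ℕ) : ℕ :=
  (dfsTruncOrder ℓ T).idxOf v

theorem finite_edges (n : ℕ) : {T : OrderedTree | T.edges = n}.Finite := by
  induction n using Nat.strong_induction_on with
  | _ n ih =>
  have hS : {T : OrderedTree | T.edges < n}.Finite :=
    ((Set.finite_Iio n).biUnion fun m hm => ih m hm).subset fun T hT => by
      simpa using hT
  have := hS.to_subtype
  refine ((List.finite_length_le {T : OrderedTree | T.edges < n} n).image
    fun l => node (l.map Subtype.val)).subset ?_
  rintro ⟨cs⟩ h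
  simp only [Set.mem_ofPred_eq, edges] at h
  have hlt : ∀ c ∈ cs, c.edges < n := fun c hc => by
    have := List.single_le_sum (l := cs.map fun c => edges c + 1) (by simp) _
      (List.mem_map_of_mem hc)
    omega
  refine ⟨cs.attach.map fun c => ⟨c.1, hlt c.1 c.2⟩, ?_, ?_⟩
  · have := List.length_le_sum_of_one_le (cs.map fun c => edges c + 1) (by simp)
    simp only [Set.mem_ofPred_eq, List.length_map, List.length_attach] at this ⊢
    omega
  · simp [Function.comp_def]

/-- The set of all ordered trees with `n` edges. -/
noncomputable def treesWithEdges (n : ℕ) : Finset OrderedTree :=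
  (finite_edges n).toFinset

/-- The sum of the depth-first scores of all the nodes at level `ℓ` in all the ordered trees
with `n` edges. -/
noncomputable def totalD (n ℓ : ℕ) : ℕ :=
  ∑ T ∈ treesWithEdges n, ∑ v ∈ lev T ℓ, dfsScore T v

/-- The sum of the truncated depth-first scores (for the target level `ℓ`) of all the nodes at
level `ℓ` in all the ordered trees with `n` edges. -/
noncomputable def totalDTrunc (n ℓ : ℕ) : ℕ :=
  ∑ T ∈ treesWithEdges n, ∑ v ∈ lev T ℓ, dfsTruncScore ℓ T v

end OrderedTree

/-- The binomial coefficient `a (a - 1) ⋯ (a - b + 1) / b!` for integers `a` and `b`, which is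
`0` for `b < 0` and `1` for `b = 0`. -/
def intBinom (a b : ℤ) : ℤ :=
  if 0 ≤ b then Ring.choose a b.toNat else 0

namespace OrderedTree

/-! Truncated DFS visits the nodes of level at most `ℓ` in the same order as DFS. Hence the two
totals differ by the number of pairs `(u, v)`, over all trees, with `u` before `v` in pre-order, `u`
below level `ℓ` and `v` at level `ℓ` (`totalD_eq`).

Splitting off the leftmost subtree of the root turns this count into a recurrence for generating
functions. Let `c = 1 + X c ^ 2` be the Catalan series, `x = X c ^ 2` and `S = 1 / (1 - 2 X c)`. The
series of the pairs is then `S x ^ (ℓ + 2) (1 - x ^ ℓ) / (1 - x)` (`genFun_dropCount`).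

Each sum on the right is also a coefficient of a series: powers of `c` give the ballot-type
quotients (`coeff_catalanGF_pow`), `S` and `S ^ 2` give `binom (2k) k` and `4 ^ k`, and the
alternating sums come from Fibonacci-type polynomials, which are rational in `x` (`fibGF_mul`,
`fibDerivGF_mul`). Since `c = 1 + x` and `S = (1 + x) / (1 - x)`, what remains is an identity of
rational expressions in `x` and `x ^ ℓ` (`two_mul_genFun_dropCount`). -/

theorem cons_induction {P : OrderedTree → Prop} (leaf : P (node []))
    (cons : ∀ c cs, P c → P (node cs) → P (node (c :: cs))) : ∀ T, P T
  | node [] => leaf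
  | node (c :: cs) => cons c cs (cons_induction leaf cons c) (cons_induction leaf cons (node cs))

/-! ### Depth-first order and the leftmost-subtree decomposition. -/

/-- The list of the levels of the nodes, in depth-first order. -/
def levels (T : OrderedTree) : List ℕ := T.dfsOrder.map List.length

/-- Move an address one child of the root to the right. -/
def shiftAddress : List ℕ → List ℕ
  | [] => []
  | i :: v => (i + 1) :: v

theorem shiftAddress_injective : Function.Injective shiftAddress := by
  rintro (_ | ⟨i, v⟩) (_ | ⟨j, w⟩) <;> simp [shiftAddress]

theorem length_shiftAddress (v : List ℕ) : (shiftAddress v).length = v.length := by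
  cases v <;> simp [shiftAddress]

theorem map_mapIdx {α β γ : Type*} (f : ℕ → α → β) (g : β → γ) (l : List α) :
    (l.mapIdx f).map g = l.mapIdx fun i a => g (f i a) :=
  List.ext_getElem (by simp) fun i _ _ => by simp

theorem dfsOrder_leaf : dfsOrder (node []) = [[]] := by simp [dfsOrder_node]

theorem dfsOrder_cons (c : OrderedTree) (cs : List OrderedTree) :
    dfsOrder (node (c :: cs)) =
      [] :: ((dfsOrder c).map (0 :: ·) ++ (dfsOrder (node cs)).tail.map shiftAddress) := by
  simp only [dfsOrder_node, List.mapIdx_cons, List.flatten_cons, List.tail_cons, List.map_flatten,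
    map_mapIdx, List.map_map]
  rfl

theorem nodup_dfsOrder (T : OrderedTree) : (dfsOrder T).Nodup := by
  induction T using cons_induction with
  | leaf => simp [dfsOrder_leaf]
  | cons c cs hc hcs =>
    have hne : [] ∉ (dfsOrder (node cs)).tail := by
      rw [dfsOrder_node] at hcs ⊢
      exact (List.nodup_cons.1 hcs).1
    rw [dfsOrder_cons, List.nodup_cons, List.nodup_append]
    refine ⟨?_, hc.map (List.cons_injective), hcs.tail.map shiftAddress_injective, ?_⟩
    · simp only [List.mem_append, List.mem_map, reduceCtorEq, and_false, exists_false, false_or,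
        not_exists, not_and]
      rintro (_ | ⟨i, v⟩) hv
      · exact absurd hv hne
      · simp [shiftAddress]
    · simp only [List.mem_map]
      rintro _ ⟨v, -, rfl⟩ _ ⟨(_ | ⟨i, w⟩), hw, rfl⟩
      · exact absurd hw hne
      · simp [shiftAddress]

theorem dfsTruncOrder_eq_filter : ∀ (ℓ : ℕ) (T : OrderedTree),
    dfsTruncOrder ℓ T = (dfsOrder T).filter (fun v => v.length ≤ ℓ)
  | 0, node cs => by
    simp only [dfsTruncOrder, dfsOrder_node, List.filter_cons, List.length_nil, le_refl,
      decide_true, if_true, List.cons.injEq, true_and]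
    symm
    simp only [List.filter_eq_nil_iff, List.mem_flatten, List.mem_mapIdx]
    rintro _ ⟨_, ⟨i, h, rfl⟩, hv⟩
    obtain ⟨w, -, rfl⟩ := List.mem_map.1 hv
    simp
  | ℓ + 1, node cs => by
    simp only [dfsTruncOrder, dfsOrder_node, List.filter_cons, List.length_nil, Nat.zero_le,
      decide_true, if_true, List.filter_flatten, map_mapIdx,
      List.filter_map, Function.comp_def, List.length_cons, Nat.add_le_add_iff_right,
      dfsTruncOrder_eq_filter ℓ]

/-! ### The score difference as a count of pairs in the level sequence. -/

/-- The number of pairs of positions `i < j` of the list such that the entry at `i` is greater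
than `ℓ` and the entry at `j` equals `ℓ`. -/
def dropCount (ℓ : ℕ) : List ℕ → ℕ
  | [] => 0
  | a :: L => dropCount ℓ L + if ℓ < a then L.count ℓ else 0

theorem dropCount_append (ℓ : ℕ) (L M : List ℕ) :
    dropCount ℓ (L ++ M) = dropCount ℓ L + dropCount ℓ M + L.countP (ℓ < ·) * M.count ℓ := by
  induction L with
  | nil => simp [dropCount]
  | cons a L ih =>
    simp only [List.cons_append, dropCount, ih, List.count_append, List.countP_cons,
      decide_eq_true_eq]
    split_ifs <;> ring

theorem count_map_succ (ℓ : ℕ) (L : List ℕ) : (L.map (· + 1)).count (ℓ + 1) = L.count ℓ :=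
  List.count_map_of_injective L _ (add_left_injective 1) ℓ

theorem countP_map_succ (ℓ : ℕ) (L : List ℕ) :
    (L.map (· + 1)).countP (ℓ + 1 < ·) = L.countP (ℓ < ·) := by
  simp [List.countP_map, Function.comp_def]

theorem dropCount_map_succ (ℓ : ℕ) (L : List ℕ) :
    dropCount (ℓ + 1) (L.map (· + 1)) = dropCount ℓ L := by
  induction L with
  | nil => rfl
  | cons a L ih => simp only [List.map_cons, dropCount, ih, count_map_succ, Nat.add_lt_add_iff_right]

/-- Filtering lowers the index of an entry by the number of deleted entries before it, here those of
length greater than `ℓ`. -/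
theorem sum_idxOf_filter (ℓ : ℕ) (L : List (List ℕ)) (hL : L.Nodup) :
    ((L.filter fun v => v.length = ℓ).map fun v => L.idxOf v).sum =
      ((L.filter fun v => v.length = ℓ).map fun v =>
        (L.filter fun v => v.length ≤ ℓ).idxOf v).sum + dropCount ℓ (L.map List.length) := by
  induction L with
  | nil => simp [dropCount]
  | cons a L ih =>
    obtain ⟨ha, hL⟩ := List.nodup_cons.1 hL
    have ih := ih hL
    -- As `a` is not in `L`, prepending it raises every index by one. The list `M` is left free in
    -- order to serve for `L` and for its filtered version.
    have key : ∀ M : List (List ℕ), ((L.filter fun v => v.length = ℓ).map fun v =>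
        (a :: M).idxOf v).sum = ((L.filter fun v => v.length = ℓ).map fun v =>
        M.idxOf v).sum + (L.map List.length).count ℓ := by
      intro M
      have h1 : ∀ v ∈ (L.filter fun v => v.length = ℓ), (a :: M).idxOf v = M.idxOf v + 1 := by
        intro v hv
        rw [List.idxOf_cons_ne]
        rintro rfl
        exact ha (List.mem_filter.1 hv).1
      rw [List.map_congr_left h1, List.sum_map_add]
      rw [List.count, List.countP_map, List.countP_eq_length_filter]
      simp [Function.comp_def]
      rfl
    simp only [List.filter_cons, List.map_cons, dropCount, decide_eq_true_eq]
    rcases lt_trichotomy a.length ℓ with h | h | h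
    · simp only [h.ne, h.le, h.not_gt, if_true, if_false, key, ih]
      ring
    · simp only [h, le_refl, lt_irrefl, if_true, if_false, List.map_cons, List.sum_cons,
        List.idxOf_cons_self, key, ih]
      ring
    · simp only [h.ne', h.not_ge, h, if_true, if_false, key, ih]
      ring

theorem sum_lev (T : OrderedTree) (ℓ : ℕ) (f : List ℕ → ℕ) :
    ∑ v ∈ lev T ℓ, f v = (((dfsOrder T).filter fun v => v.length = ℓ).map f).sum := by
  rw [← List.sum_toFinset f ((nodup_dfsOrder T).filter _)]
  congr 1
  ext v
  simp [lev, mem_dfsOrder]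

theorem sum_dfsScore (T : OrderedTree) (ℓ : ℕ) :
    ∑ v ∈ lev T ℓ, dfsScore T v =
      ∑ v ∈ lev T ℓ, dfsTruncScore ℓ T v + dropCount ℓ (levels T) := by
  simp only [sum_lev, dfsScore, dfsTruncScore, dfsTruncOrder_eq_filter]
  exact sum_idxOf_filter ℓ _ (nodup_dfsOrder T)

theorem totalD_eq (n ℓ : ℕ) : totalD n ℓ =
    totalDTrunc n ℓ + ∑ T ∈ treesWithEdges n, dropCount ℓ (levels T) := by
  simp only [totalD, totalDTrunc, sum_dfsScore, Finset.sum_add_distrib]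

theorem levels_node (cs : List OrderedTree) :
    levels (node cs) = 0 :: (levels (node cs)).tail := by
  simp [levels, dfsOrder_node]

theorem levels_leaf : levels (node []) = [0] := by simp [levels, dfsOrder_leaf]

theorem levels_cons (c : OrderedTree) (cs : List OrderedTree) :
    levels (node (c :: cs)) = 0 :: ((levels c).map (· + 1) ++ (levels (node cs)).tail) := by
  simp [levels, dfsOrder_cons, Function.comp_def, length_shiftAddress, ← List.map_tail]

/-- The number of nodes at level `ℓ`. -/
def levelCount (ℓ : ℕ) (T : OrderedTree) : ℕ := (levels T).count ℓ

/-- The number of nodes below level `ℓ`. -/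
def belowCount (ℓ : ℕ) (T : OrderedTree) : ℕ := (levels T).countP (ℓ < ·)

theorem levelCount_succ_cons (ℓ : ℕ) (c : OrderedTree) (cs : List OrderedTree) :
    levelCount (ℓ + 1) (node (c :: cs)) = levelCount ℓ c + levelCount (ℓ + 1) (node cs) := by
  rw [levelCount, levelCount, levelCount, levels_cons, levels_node cs]
  simp [count_map_succ]

theorem belowCount_succ_cons (ℓ : ℕ) (c : OrderedTree) (cs : List OrderedTree) :
    belowCount (ℓ + 1) (node (c :: cs)) = belowCount ℓ c + belowCount (ℓ + 1) (node cs) := by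
  rw [belowCount, belowCount, belowCount, levels_cons, levels_node cs]
  simp only [List.countP_cons, List.countP_append, countP_map_succ]
  simp

/-- A pair lies inside `c`, or outside `c`, or has its deeper node in `c` and its later node
outside. The reverse mixed case cannot occur, because `c` is visited first; the root is too high to
take part. -/
theorem dropCount_succ_cons (ℓ : ℕ) (c : OrderedTree) (cs : List OrderedTree) :
    dropCount (ℓ + 1) (levels (node (c :: cs))) = dropCount ℓ (levels c) +
      dropCount (ℓ + 1) (levels (node cs)) + belowCount ℓ c * levelCount (ℓ + 1) (node cs) := by
  rw [belowCount, levelCount, levels_cons, levels_node cs]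
  simp only [dropCount, dropCount_append, dropCount_map_succ, countP_map_succ, List.tail_cons]
  simp

theorem levels_tail_pos (T : OrderedTree) : ∀ a ∈ (levels T).tail, 0 < a := by
  induction T using cons_induction with
  | leaf => simp [levels_leaf]
  | cons c cs _ h =>
    rw [levels_cons]
    simp only [List.tail_cons, List.mem_append, List.mem_map]
    rintro a (⟨b, -, rfl⟩ | ha)
    · omega
    · exact h a ha

theorem levelCount_zero (T : OrderedTree) : levelCount 0 T = 1 := by
  obtain ⟨cs⟩ := T
  have := levels_tail_pos (node cs)
  rw [levelCount, levels_node, List.count_cons_self, List.count_eq_zero_of_not_mem]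
  exact fun h => (this 0 h).false

theorem dropCount_zero_levels (T : OrderedTree) : dropCount 0 (levels T) = 0 := by
  have key : ∀ L : List ℕ, (∀ a ∈ L, 0 < a) → dropCount 0 L = 0 := by
    intro L
    induction L with
    | nil => simp [dropCount]
    | cons a L ih =>
      intro h
      have h' := fun b hb => h b (List.mem_cons_of_mem a hb)
      have : L.count 0 = 0 := List.count_eq_zero_of_not_mem fun h0 => (h' 0 h0).false
      simp [dropCount, ih h', this]
  obtain ⟨cs⟩ := T
  have := levels_tail_pos (node cs)
  rw [levels_node]
  simp [dropCount, key _ this]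

theorem edges_cons (c : OrderedTree) (cs : List OrderedTree) :
    edges (node (c :: cs)) = edges c + edges (node cs) + 1 := by
  simp only [edges, List.map_cons, List.sum_cons]
  ring

theorem edges_leaf : edges (node []) = 0 := by simp [edges]

theorem belowCount_zero (T : OrderedTree) : belowCount 0 T = edges T := by
  have length_levels : (levels T).length = edges T + 1 := by
    induction T using cons_induction with
    | leaf => simp [levels_leaf, edges_leaf]
    | cons c cs hc hcs =>
      rw [levels_cons, edges_cons]
      rw [levels_node] at hcs
      simp only [List.length_cons, List.length_append, List.length_map] at hcs ⊢
      omega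
  have := levels_tail_pos T
  obtain ⟨cs⟩ := T
  rw [levels_node] at length_levels
  rw [belowCount, levels_node, List.countP_cons, List.countP_eq_length.2 (by simpa using this)]
  simpa using length_levels

theorem mem_treesWithEdges (n : ℕ) (T : OrderedTree) : T ∈ treesWithEdges n ↔ edges T = n := by
  simp [treesWithEdges]

theorem treesWithEdges_zero : treesWithEdges 0 = {node []} := by
  ext ⟨cs⟩
  cases cs <;> simp [mem_treesWithEdges, edges]

/-! ### Generating functions of tree statistics. -/

/-- The tree obtained by grafting `c` as a new leftmost subtree of the root of `T`. -/
def graft (c : OrderedTree) : OrderedTree → OrderedTree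
  | node cs => node (c :: cs)

theorem edges_graft (c T : OrderedTree) : edges (graft c T) = edges c + edges T + 1 := by
  obtain ⟨cs⟩ := T
  exact edges_cons c cs

theorem sum_treesWithEdges_succ (n : ℕ) (f : OrderedTree → ℚ) :
    ∑ T ∈ treesWithEdges (n + 1), f T = ∑ p ∈ Finset.HasAntidiagonal.antidiagonal n,
      ∑ c ∈ treesWithEdges p.1, ∑ T ∈ treesWithEdges p.2, f (graft c T) := by
  simp only [← Finset.sum_product']
  rw [Finset.sum_sigma' (Finset.HasAntidiagonal.antidiagonal n)
    (fun p => treesWithEdges p.1 ×ˢ treesWithEdges p.2) (fun _ q => f (graft q.1 q.2))]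
  symm
  refine Finset.sum_bij (fun q _ => graft q.2.1 q.2.2) ?_ ?_ ?_ (fun _ _ => rfl)
  · rintro ⟨⟨i, j⟩, c, T⟩ h
    simp only [Finset.mem_sigma, Finset.HasAntidiagonal.mem_antidiagonal, Finset.mem_product,
      mem_treesWithEdges] at h
    rw [mem_treesWithEdges, edges_graft, h.2.1, h.2.2, h.1]
  · rintro ⟨⟨i, j⟩, c, ⟨cs⟩⟩ h ⟨⟨i', j'⟩, c', ⟨cs'⟩⟩ h' he
    simp only [Finset.mem_sigma, Finset.HasAntidiagonal.mem_antidiagonal, Finset.mem_product,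
      mem_treesWithEdges] at h h'
    simp only [graft, node.injEq, List.cons.injEq] at he
    obtain ⟨rfl, rfl⟩ := he
    obtain ⟨-, rfl, rfl⟩ := h
    obtain ⟨-, rfl, rfl⟩ := h'
    rfl
  · rintro ⟨_ | ⟨c, cs⟩⟩ h
    · simp [mem_treesWithEdges, edges] at h
    · rw [mem_treesWithEdges, edges_cons] at h
      exact ⟨⟨⟨edges c, edges (node cs)⟩, c, node cs⟩, by
        simp only [Finset.mem_sigma, Finset.HasAntidiagonal.mem_antidiagonal, Finset.mem_product,
          mem_treesWithEdges, and_true]; omega, rfl⟩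

open PowerSeries

/-- The generating function, by the number of edges, of a weight on ordered trees. -/
noncomputable def genFun (f : OrderedTree → ℚ) : ℚ⟦X⟧ :=
  PowerSeries.mk fun n => ∑ T ∈ treesWithEdges n, f T

/-- Grafting is a bijection from pairs of trees to trees with at least one edge, and it adds one
edge: hence the products and the factor `X`. -/
theorem genFun_eq_of_graft {ι : Type*} (s : Finset ι) (f : OrderedTree → ℚ)
    (g h : ι → OrderedTree → ℚ)
    (hf : ∀ c T, f (graft c T) = ∑ i ∈ s, g i c * h i T) :
    genFun f = C (f (node [])) + X * ∑ i ∈ s, genFun (g i) * genFun (h i) := by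
  ext n
  cases n with
  | zero => simp [genFun, treesWithEdges_zero]
  | succ n =>
    rw [map_add, coeff_succ_X_mul, map_sum]
    simp only [genFun, coeff_mk, coeff_mul, sum_treesWithEdges_succ, coeff_C, hf]
    simp only [Nat.succ_ne_zero, if_false, zero_add, Finset.sum_mul_sum]
    rw [Finset.sum_comm]
    refine Finset.sum_congr rfl fun p _ => ?_
    refine Eq.trans ?_ Finset.sum_comm
    exact Finset.sum_congr rfl fun c _ => Finset.sum_comm

/-- The generating function of the ordered trees by the number of edges. -/
noncomputable def catalanGF : ℚ⟦X⟧ := genFun fun _ => 1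

theorem catalanGF_eq : catalanGF = 1 + X * catalanGF ^ 2 := by
  have := genFun_eq_of_graft (Finset.univ : Finset (Fin 1)) (fun _ => 1)
    (fun _ _ => (1 : ℚ)) (fun _ _ => (1 : ℚ)) (by simp)
  simpa [catalanGF, sq] using this

theorem genFun_levelCount (ℓ : ℕ) :
    genFun (fun T => levelCount ℓ T) = (X * catalanGF ^ 2) ^ ℓ * catalanGF := by
  induction ℓ with
  | zero => simp [levelCount_zero, catalanGF]
  | succ ℓ ih =>
    have h := genFun_eq_of_graft (Finset.univ : Finset (Fin 2)) (fun T => levelCount (ℓ + 1) T)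
      ![fun T => levelCount ℓ T, fun _ => 1] ![fun _ => 1, fun T => levelCount (ℓ + 1) T] (by
        rintro c ⟨cs⟩
        simp [graft, levelCount_succ_cons])
    simp only [Fin.sum_univ_two, Matrix.cons_val_zero, Matrix.cons_val_one] at h
    rw [← catalanGF, ih] at h
    simp only [levelCount, levels_leaf] at h ⊢
    simp at h
    clear ih
    have hc := catalanGF_eq
    generalize catalanGF = c at *
    generalize genFun _ = y at *
    linear_combination c * h - y * hc

/-- At `ℓ = 0` the weight is the number of edges, whose series `y` solves `y = X (2 c y + c ^ 2)`.
Each further level contributes a factor `X c / (1 - X c) = X c ^ 2`. -/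
theorem genFun_belowCount (ℓ : ℕ) {S : ℚ⟦X⟧} (hS : S * (1 - 2 * X * catalanGF) = 1) :
    genFun (fun T => belowCount ℓ T) = (X * catalanGF ^ 2) ^ (ℓ + 1) * S := by
  induction ℓ with
  | zero =>
    have h := genFun_eq_of_graft (Finset.univ : Finset (Fin 3)) (fun T => edges T)
      ![fun T => edges T, fun _ => 1, fun _ => 1] ![fun _ => 1, fun T => edges T, fun _ => 1] (by
        intro c T
        simp [edges_graft, Fin.sum_univ_three])
    simp only [Fin.sum_univ_three, Matrix.cons_val_zero, Matrix.cons_val_one,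
      Matrix.cons_val] at h
    rw [← catalanGF] at h
    simp only [belowCount_zero]
    simp only [edges_leaf, Nat.cast_zero, map_zero, zero_add] at h
    generalize catalanGF = c at *
    generalize genFun _ = y at *
    linear_combination S * h - y * hS
  | succ ℓ ih =>
    have h := genFun_eq_of_graft (Finset.univ : Finset (Fin 2)) (fun T => belowCount (ℓ + 1) T)
      ![fun T => belowCount ℓ T, fun _ => 1] ![fun _ => 1, fun T => belowCount (ℓ + 1) T] (by
        rintro c ⟨cs⟩
        simp [graft, belowCount_succ_cons])
    simp only [Fin.sum_univ_two, Matrix.cons_val_zero, Matrix.cons_val_one] at h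
    rw [← catalanGF, ih] at h
    simp only [belowCount, levels_leaf] at h ⊢
    simp at h
    clear ih
    have hc := catalanGF_eq
    generalize catalanGF = c at *
    generalize genFun _ = y at *
    linear_combination c * h - y * hc

theorem genFun_dropCount (ℓ : ℕ) {S : ℚ⟦X⟧} (hS : S * (1 - 2 * X * catalanGF) = 1) :
    genFun (fun T => dropCount ℓ (levels T)) * (1 - X * catalanGF ^ 2) =
      S * (X * catalanGF ^ 2) ^ (ℓ + 2) * (1 - (X * catalanGF ^ 2) ^ ℓ) := by
  induction ℓ with
  | zero =>
    simp only [dropCount_zero_levels]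
    simp [genFun]
    left
    ext
    simp
  | succ ℓ ih =>
    have h := genFun_eq_of_graft (Finset.univ : Finset (Fin 3))
      (fun T => dropCount (ℓ + 1) (levels T))
      ![fun T => dropCount ℓ (levels T), fun _ => 1, fun T => belowCount ℓ T]
      ![fun _ => 1, fun T => dropCount (ℓ + 1) (levels T), fun T => levelCount (ℓ + 1) T] (by
        rintro c ⟨cs⟩
        simp [graft, dropCount_succ_cons, Fin.sum_univ_three])
    simp only [Fin.sum_univ_three, Matrix.cons_val_zero, Matrix.cons_val_one,
      Matrix.cons_val] at h
    rw [← catalanGF, genFun_belowCount ℓ hS, genFun_levelCount] at h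
    rw [levels_leaf] at h
    simp only [dropCount] at h
    simp at h
    have hc := catalanGF_eq
    generalize catalanGF = c at *
    generalize genFun (fun T => (dropCount ℓ (levels T) : ℚ)) = d at *
    generalize genFun _ = y at *
    -- Since `c (1 - X c) = 1`, multiplying by `c` solves the recurrence for `y`. The exponent
    -- collects `ℓ + 1` from the nodes below, `ℓ + 1` from the level count, and one from `X c ^ 2`.
    have hy : y = X * c ^ 2 * d + (X * c ^ 2) ^ (2 * ℓ + 3) * S := by
      linear_combination c * h - y * hc
    rw [hy]
    linear_combination X * c ^ 2 * ih

/-! ### Binomial series and the coefficients of powers of the Catalan series. -/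

/-- The power series with the coefficients `binom (2 n + p) n`. -/
noncomputable def chooseGF (p : ℕ) : ℚ⟦X⟧ := PowerSeries.mk fun n => ((2 * n + p).choose n : ℚ)

theorem chooseGF_succ (p : ℕ) : chooseGF (p + 1) = chooseGF p + X * chooseGF (p + 2) := by
  ext n
  cases n with
  | zero => simp [chooseGF]
  | succ n =>
    rw [map_add, coeff_succ_X_mul]
    simp only [chooseGF, coeff_mk]
    rw [show 2 * (n + 1) + (p + 1) = (2 * n + p + 2) + 1 by ring, Nat.choose_succ_succ]
    push_cast
    rw [show 2 * (n + 1) + p = 2 * n + p + 2 by ring, show 2 * n + (p + 2) = 2 * n + p + 2 by ring]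
    ring

theorem chooseGF_zero : chooseGF 0 = 1 + (X * chooseGF 1 + X * chooseGF 1) := by
  ext n
  cases n with
  | zero => simp [chooseGF]
  | succ n =>
    rw [map_add, map_add, coeff_succ_X_mul, coeff_one, if_neg n.succ_ne_zero]
    simp only [chooseGF, coeff_mk]
    rw [show 2 * (n + 1) + 0 = (2 * n + 1) + 1 by ring, Nat.choose_succ_succ,
      Nat.choose_symm_half]
    push_cast
    ring

theorem eq_zero_of_forall_X_pow_dvd {f : ℚ⟦X⟧} (h : ∀ k, X ^ k ∣ f) : f = 0 := by
  ext n
  exact X_pow_dvd_iff.1 (h (n + 1)) n n.lt_succ_self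

/-- By Pascal's rule the defect at `p` is `X c` times the defect at `p + 1`, so it is divisible by
every power of `X`. -/
theorem chooseGF_succ_eq_mul (p : ℕ) : chooseGF (p + 1) = catalanGF * chooseGF p := by
  have step : ∀ p, chooseGF (p + 1) - catalanGF * chooseGF p =
      X * catalanGF * (chooseGF (p + 2) - catalanGF * chooseGF (p + 1)) := fun p => by
    linear_combination catalanGF * chooseGF_succ p - chooseGF (p + 1) * catalanGF_eq
  have dvd : ∀ k p, X ^ k ∣ chooseGF (p + 1) - catalanGF * chooseGF p := by
    intro k
    induction k with
    | zero => simp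
    | succ k ih =>
      intro p
      rw [step, mul_assoc, pow_succ']
      exact mul_dvd_mul_left _ ((ih (p + 1)).mul_left _)
  exact sub_eq_zero.1 (eq_zero_of_forall_X_pow_dvd fun k => dvd k p)

theorem chooseGF_eq (p : ℕ) : chooseGF p = chooseGF 0 * catalanGF ^ p := by
  induction p with
  | zero => simp
  | succ p ih => rw [chooseGF_succ_eq_mul, ih]; ring

theorem chooseGF_zero_mul : chooseGF 0 * (1 - 2 * X * catalanGF) = 1 := by
  linear_combination chooseGF_zero + 2 * X * chooseGF_succ_eq_mul 0

theorem chooseGF_zero_mul_one_sub : chooseGF 0 * (1 - X * catalanGF ^ 2) = catalanGF := by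
  linear_combination catalanGF * chooseGF_zero_mul - chooseGF 0 * catalanGF_eq

/-- Multiplying `chooseGF 0 * (1 - X c ^ 2) = c` by `c ^ p` writes the power as a difference of two
binomial series. -/
theorem coeff_catalanGF_pow (p n : ℕ) :
    coeff n (catalanGF ^ (p + 1)) = (p + 1 : ℚ) / (n + p + 1) * ((2 * n + p).choose n : ℚ) := by
  have h : catalanGF ^ (p + 1) = chooseGF p - X * chooseGF (p + 2) := by
    rw [chooseGF_eq p, chooseGF_eq (p + 2)]
    linear_combination - catalanGF ^ p * chooseGF_zero_mul_one_sub
  rw [h]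
  cases n with
  | zero =>
    have : (p : ℚ) + 1 ≠ 0 := by positivity
    simp [chooseGF, this]
  | succ n =>
    rw [map_sub, coeff_succ_X_mul]
    simp only [chooseGF, coeff_mk]
    have h1 := Nat.choose_succ_right_eq (2 * n + p + 2) n
    rw [show 2 * n + p + 2 - n = n + p + 2 by omega] at h1
    rw [show 2 * (n + 1) + p = 2 * n + p + 2 by ring, show 2 * n + (p + 2) = 2 * n + p + 2 by ring]
    have h2 : ((2 * n + p + 2).choose (n + 1) : ℚ) * (n + 1) =
      (2 * n + p + 2).choose n * (n + p + 2) := by exact_mod_cast h1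
    push_cast
    have : (n : ℚ) + 1 + p + 1 ≠ 0 := by positivity
    field_simp
    linear_combination h2

theorem coeff_X_pow_mul_catalanGF_pow (m p n : ℕ) (h : m ≤ n) :
    coeff n (X ^ m * catalanGF ^ (p + 1)) =
      (p + 1 : ℚ) / (n - m + p + 1) * ((2 * (n - m) + p).choose (n - m) : ℚ) := by
  rw [coeff_X_pow_mul', if_pos h, coeff_catalanGF_pow, Nat.cast_sub h]

/-! ### Fibonacci-type polynomials for the alternating sums. -/

/-- The polynomials `∑ (-1) ^ k * binom (m - k) k * X ^ k`, as power series. -/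
noncomputable def fibGF (m : ℕ) : ℚ⟦X⟧ :=
  ∑ k ∈ Finset.range (m + 1), C ((-1 : ℚ) ^ k * ((m - k).choose k : ℚ)) * X ^ k

/-- The polynomials `∑ k * (-1) ^ k * binom (m - k) k * X ^ k`, as power series. -/
noncomputable def fibDerivGF (m : ℕ) : ℚ⟦X⟧ :=
  ∑ k ∈ Finset.range (m + 1), C ((k : ℚ) * ((-1 : ℚ) ^ k * ((m - k).choose k : ℚ))) * X ^ k

theorem coeff_fibGF (m n : ℕ) :
    coeff n (fibGF m) = (-1 : ℚ) ^ n * ((m - n).choose n : ℚ) := by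
  simp only [fibGF, map_sum, coeff_C_mul, coeff_X_pow]
  simp only [mul_ite, mul_one, mul_zero, Finset.sum_ite_eq, Finset.mem_range]
  split_ifs with h
  · rfl
  · rw [Nat.choose_eq_zero_of_lt (by omega)]
    simp

theorem coeff_fibDerivGF (m n : ℕ) :
    coeff n (fibDerivGF m) = (n : ℚ) * ((-1 : ℚ) ^ n * ((m - n).choose n : ℚ)) := by
  simp only [fibDerivGF, map_sum, coeff_C_mul, coeff_X_pow]
  simp only [mul_ite, mul_one, mul_zero, Finset.sum_ite_eq, Finset.mem_range]
  split_ifs with h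
  · rfl
  · rw [Nat.choose_eq_zero_of_lt (by omega)]
    simp

theorem choose_sub_succ (m n : ℕ) :
    ((m + 2 - (n + 1)).choose (n + 1)) =
      ((m + 1 - (n + 1)).choose (n + 1)) + (m - n).choose n := by
  rcases le_or_gt n m with h | h
  · rw [show m + 2 - (n + 1) = (m - n) + 1 by omega, Nat.choose_succ_succ,
      show m + 1 - (n + 1) = m - n by omega, add_comm]
  · rw [Nat.choose_eq_zero_of_lt (by omega), Nat.choose_eq_zero_of_lt (by omega),
      Nat.choose_eq_zero_of_lt (by omega)]

theorem fibGF_succ_succ (m : ℕ) : fibGF (m + 2) = fibGF (m + 1) - X * fibGF m := by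
  ext n
  cases n with
  | zero => rw [map_sub, coeff_fibGF, coeff_fibGF]; simp
  | succ n =>
    rw [map_sub, coeff_succ_X_mul, coeff_fibGF, coeff_fibGF, coeff_fibGF, choose_sub_succ]
    push_cast
    ring

theorem fibDerivGF_succ_succ (m : ℕ) :
    fibDerivGF (m + 2) = fibDerivGF (m + 1) - X * (fibDerivGF m + fibGF m) := by
  ext n
  cases n with
  | zero => rw [map_sub, coeff_fibDerivGF, coeff_fibDerivGF]; simp
  | succ n =>
    rw [map_sub, coeff_succ_X_mul, map_add, coeff_fibGF, coeff_fibDerivGF, coeff_fibDerivGF,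
      coeff_fibDerivGF, choose_sub_succ]
    push_cast
    ring

/-- With `X = x / (1 + x) ^ 2`, the recurrence `F (m + 2) = F (m + 1) - X F m` becomes, for `F m * c
^ m`, a linear one with characteristic roots `1` and `x`. -/
theorem fibGF_mul (m : ℕ) : fibGF m * catalanGF ^ m * (1 - X * catalanGF ^ 2) =
    1 - (X * catalanGF ^ 2) ^ (m + 1) := by
  have hc := catalanGF_eq
  induction m using Nat.twoStepInduction with
  | zero => simp [fibGF]
  | one =>
    simp [fibGF, Finset.sum_range_succ]
    generalize catalanGF = c at *
    linear_combination (1 - X * c ^ 2) * hc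
  | more m h1 h2 =>
    rw [fibGF_succ_succ]
    generalize catalanGF = c at *
    linear_combination c * h2 - X * c ^ 2 * h1 + (1 - (X * c ^ 2) ^ (m + 2)) * hc

/-- The right side is found by applying `X d/dX = x (1 + x) / (1 - x) d/dx` to the closed form in
`fibGF_mul`; the recurrence then verifies it. -/
theorem fibDerivGF_mul (m : ℕ) : fibDerivGF m * catalanGF ^ m * (1 - X * catalanGF ^ 2) ^ 3 =
    X * catalanGF ^ 2 * (1 + X * catalanGF ^ 2) * ((1 - (X * catalanGF ^ 2) ^ (m + 1)) -
      ((m : ℚ⟦X⟧) + 1) * (X * catalanGF ^ 2) ^ m * (1 - X * catalanGF ^ 2)) -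
    X * catalanGF ^ 2 * (m : ℚ⟦X⟧) * (1 - (X * catalanGF ^ 2) ^ (m + 1)) * (1 - X * catalanGF ^ 2) := by
  have hc := catalanGF_eq
  induction m using Nat.twoStepInduction with
  | zero =>
    simp only [fibDerivGF, zero_add, Finset.sum_range_one, Nat.cast_zero, zero_mul, map_zero]
    ring
  | one =>
    have : fibDerivGF 1 = 0 := by simp [fibDerivGF, Finset.sum_range_succ]
    rw [this]
    push_cast
    ring
  | more m h1 h2 =>
    have h0 := fibGF_mul m
    rw [fibDerivGF_succ_succ]
    generalize hx : X * catalanGF ^ 2 = x at *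
    have hxc : catalanGF = 1 + x := hc
    generalize catalanGF = c at *
    generalize fibDerivGF _ = g2 at *
    generalize fibDerivGF _ = g1 at *
    generalize fibGF _ = f at *
    push_cast at *
    have e : (g1 - X * (g2 + f)) * c ^ (m + 2) * (1 - x) ^ 3 =
        c * (g1 * c ^ (m + 1) * (1 - x) ^ 3) - x * (g2 * c ^ m * (1 - x) ^ 3) -
          x * (1 - x) ^ 2 * (f * c ^ m * (1 - x)) := by
      rw [← hx]
      ring
    rw [e, h1, h2, h0, hxc]
    ring

/-! ### Coefficients in terms of integer binomials, and the three sums. -/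

theorem intBinom_natCast (a b : ℕ) : intBinom a b = (a.choose b : ℤ) := by
  simp [intBinom, Ring.choose_natCast]

theorem intBinom_of_neg (a : ℤ) {b : ℤ} (h : b < 0) : intBinom a b = 0 := if_neg h.not_ge

/-- No bound on `m` is needed: for `m > n` the lower index is negative and both sides vanish. -/
theorem coeff_X_pow_mul_catalanGF_pow' (m p n : ℕ) :
    coeff n (X ^ m * catalanGF ^ (p + 1)) =
      (p + 1 : ℚ) / (n - m + p + 1) * (intBinom (2 * (n - m) + p) (n - m) : ℚ) := by
  rcases le_or_gt m n with h | h
  · rw [coeff_X_pow_mul_catalanGF_pow m p n h, ← Nat.cast_sub h]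
    have := intBinom_natCast (2 * (n - m) + p) (n - m)
    push_cast [Nat.cast_sub h] at this
    rw [this]
    simp
  · rw [coeff_X_pow_mul', if_neg h.not_ge, intBinom_of_neg _ (by omega)]
    simp

theorem coeff_mul_eq_sum_range {f g : ℚ⟦X⟧} {m n : ℕ} (h : m ≤ n)
    (hfg : ∀ k, m < k → k ≤ n → coeff k f * coeff (n - k) g = 0) :
    coeff n (f * g) = ∑ k ∈ Finset.range (m + 1), coeff k f * coeff (n - k) g := by
  rw [coeff_mul, Finset.Nat.sum_antidiagonal_eq_sum_range_succ fun i j => coeff i f * coeff j g]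
  symm
  refine Finset.sum_subset (Finset.range_mono (by omega)) fun k hk hk' => ?_
  rw [Finset.mem_range] at hk hk'
  exact hfg k (by omega) (by omega)

theorem coeff_fibGF_mul {m n : ℕ} (h : m / 2 ≤ n) (g : ℚ⟦X⟧) :
    coeff n (fibGF m * g) = ∑ k ∈ Finset.range (m / 2 + 1),
      (-1 : ℚ) ^ k * (intBinom (m - k) k : ℚ) * coeff (n - k) g := by
  rw [coeff_mul_eq_sum_range h]
  · refine Finset.sum_congr rfl fun k hk => ?_
    rw [Finset.mem_range] at hk
    rw [coeff_fibGF, ← Nat.cast_sub (by omega), intBinom_natCast]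
    simp
  · intro k hk _
    rw [coeff_fibGF, Nat.choose_eq_zero_of_lt (by omega)]
    simp

theorem coeff_fibDerivGF_mul {m n : ℕ} (h : m / 2 ≤ n) (g : ℚ⟦X⟧) :
    coeff n (fibDerivGF m * g) = ∑ k ∈ Finset.range (m / 2 + 1),
      k * ((-1 : ℚ) ^ k * (intBinom (m - k) k : ℚ)) * coeff (n - k) g := by
  rw [coeff_mul_eq_sum_range h]
  · refine Finset.sum_congr rfl fun k hk => ?_
    rw [Finset.mem_range] at hk
    rw [coeff_fibDerivGF, ← Nat.cast_sub (by omega), intBinom_natCast]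
    simp
  · intro k hk _
    rw [coeff_fibDerivGF, Nat.choose_eq_zero_of_lt (by omega)]
    simp

theorem chooseGF_zero_sq : chooseGF 0 ^ 2 = PowerSeries.mk fun k => (4 : ℚ) ^ k := by
  have h : (1 - C (4 : ℚ) * X) * PowerSeries.mk (fun k => (4 : ℚ) ^ k) = 1 := by
    ext n
    cases n with
    | zero => simp [sub_mul, mul_assoc]
    | succ n =>
      rw [sub_mul, one_mul, mul_assoc, map_sub, coeff_C_mul, coeff_succ_X_mul, coeff_one]
      simp [pow_succ']
  have h4 : (C (4 : ℚ) : ℚ⟦X⟧) = 4 := map_ofNat C 4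
  rw [h4] at h
  have hS : chooseGF 0 ^ 2 * (1 - 4 * X) = 1 := by
    linear_combination (chooseGF 0 * (1 - 2 * X * catalanGF) + 1) * chooseGF_zero_mul +
      4 * X * chooseGF 0 ^ 2 * catalanGF_eq
  linear_combination PowerSeries.mk (fun k => (4 : ℚ) ^ k) * hS - chooseGF 0 ^ 2 * h

theorem firstSum_eq (n m : ℕ) (h : m + 1 ≤ n) :
    ∑ k ∈ Finset.range ((m + 1 + 1) / 2),
        (-1 : ℚ) ^ k * (intBinom ((m + 1 : ℕ) - 1 - k) k : ℚ) *
          (((m + 1 : ℕ) : ℚ) / (n - k + (m + 1 : ℕ)) *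
              (intBinom (2 * (n - k) + (m + 1 : ℕ) - 1) (n - k) : ℚ)
            - (6 * (m + 1 : ℕ) + 4 : ℚ) / (n - k + 2 * (m + 1 : ℕ) + 1)
              * (intBinom (2 * (n - k) + (m + 1 : ℕ) - 1) (n - k - (m + 1 : ℕ) - 1) : ℚ)) =
      coeff n (fibGF m * (X ^ 0 * catalanGF ^ (m + 1) -
        C 2 * (X ^ (m + 2) * catalanGF ^ (3 * m + 4 + 1)))) := by
  rw [coeff_fibGF_mul (by omega), show (m + 1 + 1) / 2 = m / 2 + 1 by omega]
  refine Finset.sum_congr rfl fun k hk => ?_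
  rw [Finset.mem_range] at hk
  have hk' : k ≤ n := by omega
  rw [map_sub, coeff_C_mul, coeff_X_pow_mul_catalanGF_pow', coeff_X_pow_mul_catalanGF_pow']
  push_cast [Nat.cast_sub hk']
  ring_nf

theorem secondSum_eq (n ℓ : ℕ) (h : ℓ ≤ n) :
    ∑ k ∈ Finset.range (ℓ / 2 + 1),
        (-1 : ℚ) ^ k * (intBinom (ℓ - k) k : ℚ) *
          ((3 * ℓ + 1 : ℚ) * (2 * k - ℓ + 1) / (n - k + 2 * ℓ + 1)
              * (intBinom (2 * (n - k) + ℓ) (n - k - ℓ) : ℚ)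
            - (3 * ℓ + 2 : ℚ) * k / (n - k + 2 * ℓ + 2)
              * (intBinom (2 * (n - k) + ℓ + 1) (n - k - ℓ) : ℚ)) =
      coeff n (fibDerivGF ℓ * (C 2 * (X ^ ℓ * catalanGF ^ (3 * ℓ + 1)) -
          X ^ ℓ * catalanGF ^ (3 * ℓ + 1 + 1)) -
        fibGF ℓ * (C (ℓ - 1 : ℚ) * (X ^ ℓ * catalanGF ^ (3 * ℓ + 1)))) := by
  rw [map_sub, coeff_fibGF_mul (by omega), coeff_fibDerivGF_mul (by omega),
    ← Finset.sum_sub_distrib]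
  refine Finset.sum_congr rfl fun k hk => ?_
  rw [Finset.mem_range] at hk
  have hk' : k ≤ n := by omega
  rw [map_sub, coeff_C_mul, coeff_C_mul, coeff_X_pow_mul_catalanGF_pow',
    coeff_X_pow_mul_catalanGF_pow']
  push_cast [Nat.cast_sub hk']
  ring_nf

theorem coeff_X_pow_mul_catalanGF_pow_two_mul (n k ℓ : ℕ) (h : k ≤ n - ℓ) (hℓ : ℓ ≤ n) :
    coeff (n - k) (X ^ ℓ * catalanGF ^ (2 * ℓ)) =
      2 * ((if ℓ = 0 ∧ k = n then (1 / 2 : ℚ) else (ℓ : ℚ) / (n - k + ℓ)) *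
        (intBinom (2 * n - 2 * k - 1) (n - k - ℓ) : ℚ)) := by
  have hk' : k ≤ n := by omega
  cases ℓ with
  | zero =>
    -- The series is `1` here, with constant coefficient `1 = 2 * (1 / 2) * binom (-1) 0`; this is
    -- what forces the reading `0 / 0 = 1 / 2`.
    rcases eq_or_ne k n with rfl | hk
    · simp [intBinom]
    · have : n - k ≠ 0 := by omega
      simp [hk, coeff_one, this]
  | succ m =>
    rw [show 2 * (m + 1) = (2 * m + 1) + 1 by ring, coeff_X_pow_mul_catalanGF_pow']
    push_cast [Nat.cast_sub hk']
    simp only [false_and, if_false]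
    ring_nf

theorem thirdSum_eq (n ℓ : ℕ) (h : ℓ ≤ n) :
    ∑ k ∈ Finset.range (n - ℓ + 1),
        ((if ℓ = 0 ∧ k = n then (1 / 2 : ℚ) else (ℓ : ℚ) / (n - k + ℓ))
              * ((4 : ℚ) ^ (k + 1) * (ℓ + 1) - 2 * (intBinom (2 * k) k : ℚ))
              * (intBinom (2 * n - 2 * k - 1) (n - k - ℓ) : ℚ)
            - (4 : ℚ) ^ k * (2 * ℓ + 1) * (ℓ + 1) / (n - k + ℓ + 1)
              * (intBinom (2 * n - 2 * k) (n - k - ℓ) : ℚ)) =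
      coeff n (chooseGF 0 ^ 2 * (C (ℓ + 1 : ℚ) * (C 2 * (X ^ ℓ * catalanGF ^ (2 * ℓ)) -
        X ^ ℓ * catalanGF ^ (2 * ℓ + 1))) - chooseGF 0 * (X ^ ℓ * catalanGF ^ (2 * ℓ))) := by
  have expand : ∀ f g : ℚ⟦X⟧, coeff n (f * (X ^ ℓ * g)) =
      ∑ k ∈ Finset.range (n - ℓ + 1), coeff k f * coeff (n - k) (X ^ ℓ * g) := by
    intro f g
    refine coeff_mul_eq_sum_range (Nat.sub_le n ℓ) fun k hk hk' => ?_
    rw [coeff_X_pow_mul', if_neg (by omega), mul_zero]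
  rw [show chooseGF 0 ^ 2 * (C (ℓ + 1 : ℚ) * (C 2 * (X ^ ℓ * catalanGF ^ (2 * ℓ)) -
        X ^ ℓ * catalanGF ^ (2 * ℓ + 1))) - chooseGF 0 * (X ^ ℓ * catalanGF ^ (2 * ℓ)) =
      C (ℓ + 1 : ℚ) * (C 2 * (chooseGF 0 ^ 2 * (X ^ ℓ * catalanGF ^ (2 * ℓ))) -
        chooseGF 0 ^ 2 * (X ^ ℓ * catalanGF ^ (2 * ℓ + 1))) -
          chooseGF 0 * (X ^ ℓ * catalanGF ^ (2 * ℓ)) by ring,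
    map_sub, coeff_C_mul, map_sub, coeff_C_mul, expand, expand, expand, Finset.mul_sum,
    ← Finset.sum_sub_distrib, Finset.mul_sum, ← Finset.sum_sub_distrib]
  refine Finset.sum_congr rfl fun k hk => ?_
  rw [Finset.mem_range] at hk
  have hk' : k ≤ n := by omega
  have hb : coeff k (chooseGF 0) = (intBinom (2 * k) k : ℚ) := by
    have := intBinom_natCast (2 * k) k
    push_cast at this
    rw [this]
    simp [chooseGF]
  rw [coeff_X_pow_mul_catalanGF_pow_two_mul n k ℓ (by omega) h, coeff_X_pow_mul_catalanGF_pow',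
    chooseGF_zero_sq, coeff_mk, hb]
  push_cast [Nat.cast_sub hk']
  generalize (if ℓ = 0 ∧ k = n then (1 / 2 : ℚ) else (ℓ : ℚ) / (n - k + ℓ)) = q
  rw [show 2 * ((n : ℤ) - k - ℓ) + 2 * ℓ = 2 * n - 2 * k by ring]
  ring_nf

/-! ### The identity between the generating functions, and the conclusion. -/

/-- `T` stands for the series of the first sum, which involves `fibGF (ℓ - 1)`; characterizing it by
an equation covers `ℓ = 0` as well. -/
theorem two_mul_genFun_dropCount (ℓ : ℕ) {T : ℚ⟦X⟧}
    (hT : T * (1 - X * catalanGF ^ 2) = catalanGF * (1 - (X * catalanGF ^ 2) ^ ℓ) *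
      (1 - 2 * (X * catalanGF ^ 2) ^ (ℓ + 1))) :
    2 * genFun (fun T => dropCount ℓ (levels T)) = T +
      (fibDerivGF ℓ * (C 2 * (X ^ ℓ * catalanGF ^ (3 * ℓ + 1)) -
          X ^ ℓ * catalanGF ^ (3 * ℓ + 1 + 1)) -
        fibGF ℓ * (C (ℓ - 1 : ℚ) * (X ^ ℓ * catalanGF ^ (3 * ℓ + 1)))) +
      (chooseGF 0 ^ 2 * (C (ℓ + 1 : ℚ) * (C 2 * (X ^ ℓ * catalanGF ^ (2 * ℓ)) -
        X ^ ℓ * catalanGF ^ (2 * ℓ + 1))) - chooseGF 0 * (X ^ ℓ * catalanGF ^ (2 * ℓ))) -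
      chooseGF 0 := by
  have h2 : (C (2 : ℚ) : ℚ⟦X⟧) = 2 := map_ofNat C 2
  have hl1 : (C (ℓ - 1 : ℚ) : ℚ⟦X⟧) = (ℓ : ℚ⟦X⟧) - 1 := by simp
  have hl2 : (C (ℓ + 1 : ℚ) : ℚ⟦X⟧) = (ℓ : ℚ⟦X⟧) + 1 := by simp
  rw [h2, hl1, hl2]
  -- The cube clears all denominators: the worst one comes from `fibDerivGF_mul`.
  have hne : (1 - X * catalanGF ^ 2) ^ 3 ≠ 0 := by
    intro h
    simpa using congrArg constantCoeff h
  apply mul_right_cancel₀ hne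
  have hd := genFun_dropCount ℓ chooseGF_zero_mul
  have hF := fibGF_mul ℓ
  have hG := fibDerivGF_mul ℓ
  have hS := chooseGF_zero_mul_one_sub
  have hc := catalanGF_eq
  have e1 : X ^ ℓ * catalanGF ^ (3 * ℓ + 1) =
      (X * catalanGF ^ 2) ^ ℓ * catalanGF ^ ℓ * catalanGF := by ring
  have e2 : X ^ ℓ * catalanGF ^ (3 * ℓ + 1 + 1) =
      (X * catalanGF ^ 2) ^ ℓ * catalanGF ^ ℓ * catalanGF ^ 2 := by ring
  have e3 : X ^ ℓ * catalanGF ^ (2 * ℓ) = (X * catalanGF ^ 2) ^ ℓ := by ring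
  have e4 : X ^ ℓ * catalanGF ^ (2 * ℓ + 1) = (X * catalanGF ^ 2) ^ ℓ * catalanGF := by ring
  rw [e1, e2, e3, e4]
  generalize X * catalanGF ^ 2 = x at *
  generalize catalanGF = c at *
  generalize genFun _ = d at *
  generalize fibGF ℓ = F at *
  generalize fibDerivGF ℓ = G at *
  generalize chooseGF 0 = S at *
  generalize hy : c ^ ℓ = y at *
  obtain rfl := hc
  -- The factor `S * (1 - x) + (1 + x)` on `hS` removes `S ^ 2` as a difference of squares.
  linear_combination 2 * (1 - x) ^ 2 * hd - (1 - x) ^ 2 * hT - x ^ ℓ * (1 + x) * (1 - x) * hG +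
    (ℓ - 1) * x ^ ℓ * (1 + x) * (1 - x) ^ 2 * hF +
    (2 * (1 - x) * x ^ (ℓ + 2) * (1 - x ^ ℓ) + (1 - x) ^ 2 * (x ^ ℓ + 1) -
      (1 - x) * (ℓ + 1) * x ^ ℓ * (1 - x) * (S * (1 - x) + (1 + x))) * hS

end OrderedTree

theorem theorem7p4 (n ℓ : ℕ) (hn : 1 ≤ n) (hℓ : ℓ ≤ n) :
    (OrderedTree.totalD n ℓ : ℚ) - (OrderedTree.totalDTrunc n ℓ : ℚ) =
      -- `k` runs from `0` to `⌊(ℓ - 1) / 2⌋`, so the sum is empty for `ℓ = 0`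
      1 / 2 * ∑ k ∈ Finset.range ((ℓ + 1) / 2),
        (-1 : ℚ) ^ k * (intBinom (ℓ - 1 - k) k : ℚ) *
          ((ℓ : ℚ) / (n - k + ℓ) * (intBinom (2 * (n - k) + ℓ - 1) (n - k) : ℚ)
            - (6 * ℓ + 4 : ℚ) / (n - k + 2 * ℓ + 1)
              * (intBinom (2 * (n - k) + ℓ - 1) (n - k - ℓ - 1) : ℚ))
      + 1 / 2 * ∑ k ∈ Finset.range (ℓ / 2 + 1),
        (-1 : ℚ) ^ k * (intBinom (ℓ - k) k : ℚ) *
          ((3 * ℓ + 1 : ℚ) * (2 * k - ℓ + 1) / (n - k + 2 * ℓ + 1)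
              * (intBinom (2 * (n - k) + ℓ) (n - k - ℓ) : ℚ)
            - (3 * ℓ + 2 : ℚ) * k / (n - k + 2 * ℓ + 2)
              * (intBinom (2 * (n - k) + ℓ + 1) (n - k - ℓ) : ℚ))
      + 1 / 2 * ∑ k ∈ Finset.range (n - ℓ + 1),
        -- the quotient `ℓ / (n - k + ℓ)` reads `0 / 0` for `ℓ = 0`, `k = n`; it stands for `1 / 2`
        ((if ℓ = 0 ∧ k = n then (1 / 2 : ℚ) else (ℓ : ℚ) / (n - k + ℓ))
              * ((4 : ℚ) ^ (k + 1) * (ℓ + 1) - 2 * (intBinom (2 * k) k : ℚ))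
              * (intBinom (2 * n - 2 * k - 1) (n - k - ℓ) : ℚ)
            - (4 : ℚ) ^ k * (2 * ℓ + 1) * (ℓ + 1) / (n - k + ℓ + 1)
              * (intBinom (2 * n - 2 * k) (n - k - ℓ) : ℚ))
      - 1 / 2 * (intBinom (2 * n) n : ℚ) := by
  open OrderedTree PowerSeries in
  have hlhs : (totalD n ℓ : ℚ) - (totalDTrunc n ℓ : ℚ) =
      coeff n (genFun fun T => dropCount ℓ (levels T)) := by
    rw [totalD_eq, genFun, coeff_mk]
    push_cast
    ring
  have hb : (intBinom (2 * n) n : ℚ) = coeff n (chooseGF 0) := by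
    have := intBinom_natCast (2 * n) n
    push_cast at this
    rw [this]
    simp [chooseGF]
  have hcoeff : ∀ f : ℚ⟦X⟧, coeff n (2 * f) = 2 * coeff n f := fun f => by
    rw [two_mul, map_add, two_mul]
  rw [hlhs, secondSum_eq n ℓ hℓ, thirdSum_eq n ℓ hℓ, hb]
  cases ℓ with
  | zero =>
    -- The first sum is empty, and `T = 0` is admissible because `1 - x ^ 0 = 0`.
    have key := congrArg (coeff n) (two_mul_genFun_dropCount 0 (T := 0) (by simp))
    rw [map_sub, map_add, map_add, hcoeff] at key
    simp only [zero_add, Nat.reduceDiv, Finset.range_zero, Finset.sum_empty, map_zero] at key ⊢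
    linear_combination key / 2
  | succ m =>
    have key := congrArg (coeff n) (two_mul_genFun_dropCount (m + 1)
      (T := fibGF m * (X ^ 0 * catalanGF ^ (m + 1) -
        C 2 * (X ^ (m + 2) * catalanGF ^ (3 * m + 4 + 1)))) (by
        have h2 : (C (2 : ℚ) : ℚ⟦X⟧) = 2 := map_ofNat C 2
        rw [h2]
        linear_combination (catalanGF * (1 - 2 * (X * catalanGF ^ 2) ^ (m + 2))) * fibGF_mul m))
    rw [map_sub, map_add, map_add, hcoeff] at key
    rw [firstSum_eq n m hℓ]
    linear_combination key / 2
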